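/- A seller offers one item to a buyer whose valuation $\tilde v\in[0,1]$ has an unknown distribution $P\in\mathcal P$, the set of all probability distributions on $[0,1]$. For $P,P_0\in\mathcal P$ let $d(P,P_0)=\int_0^1|\bar P(x)-\bar P_0(x)|\,dx$ with $\bar P(x)=\mathbb P_P(\tilde v>x)$. Let $\mathcal M$ be the set of direct mechanisms $(q,m):[0,1]\to[0,1]\times\mathbb R$ that are individually rational, $q(v)v-m(v)\ge 0$, and incentive compatible, $q(v)v-m(v)\ge q(\omega)v-m(\omega)$ for all $v,\omega\in[0,1]$. A distribution $Q$ of a randomized price $\tilde p\in[0,1]$ is identified with the mechanism $q(v)=\mathbb E_Q[\mathbb 1(v\ge\tilde p)]$, $m(v)=\mathbb E_Q[\tilde p\,\mathbb 1(v\ge\tilde p)]$; a posted price $p\in[0,1]$ is the case where $\tilde p=p$ is deterministic. Let the reference distribution $P_0$ be uniform on $[0,1]$, let $0<r<\tfrac12$, and let $$\Pi^*_{RO}(r)=\sup_{(q,m)\in\mathcal M}\ \inf_{P\in\mathcal P:\,d(P,P_0)\le r}\mathbb E_P[m(\tilde v)],\qquad \tau=\Pi^*_{RO}(r).$$ Robust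 optimization (RO) maximizes $\inf_{d(P,P_0)\le r}\mathbb E_P[m(\tilde v)]$; robust satisficing (RS) minimizes $k>0$ subject to $\tau-\mathbb E_P[m(\tilde v)]\le k\,d(P,P_0)$ for all $P\in\mathcal P$. Both are solved over all of $\mathcal M$ and, separately, over posted prices $p\in[0,1]$ only. Then the RO and the RS problem over $\mathcal M$ each have an optimal mechanism given by a randomized price, both posted-price problems have an optimal solution, and for every optimal randomized price distribution $q^*_{RO}$ (for RO over $\mathcal M$) and $q^*_{RS}$ (for RS over $\mathcal M$), and all optimal posted prices $p^{PP}_{RO}$ and $p^{PP}_{RS}$, $$\mathbb E_{q^*_{RO}}[\tilde p]>\mathbb E_{q^*_{RS}}[\tilde p]=p^{PP}_{RS},\qquad \mathbb E_{q^*_{RO}}[\tilde p]>p^{PP}_{RO}=\frac{1-\sqrt{2r}}{2}.$$ -/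

import Mathlib

noncomputable section

namespace RobustPricing

open MeasureTheory

/-- The set `𝒫` of all probability distributions supported on `[0,1]`. -/
abbrev Valuation : Type := ProbabilityMeasure unitInterval

/-- The complementary cumulative distribution function `x ↦ ℙ(v > x)`. -/
def ccdf (P : Valuation) (x : ℝ) : ℝ :=
  (P : Measure unitInterval).real {v | x < (v : ℝ)}

/-- The type-1 Wasserstein distance `d(P, P₀) = ∫₀¹ |P̄(x) - P̄₀(x)| dx`. -/
def wasserstein (P P₀ : Valuation) : ℝ :=
  ∫ x in (0 : ℝ)..1, |ccdf P x - ccdf P₀ x|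

/-- The Wasserstein ambiguity set `𝒲(P₀, r)`. -/
def ambiguitySet (P₀ : Valuation) (r : ℝ) : Set Valuation :=
  {P | wasserstein P P₀ ≤ r}

/-- The uniform distribution on `[0,1]`. -/
def uniform : Valuation := ⟨(volume : Measure unitInterval), inferInstance⟩

/-- An allocation rule `q` together with a payment rule `m`, for reported valuations in `[0,1]`. -/
structure Mechanism where
  /-- probability of selling the product, as a function of the report -/
  q : unitInterval → ℝ
  /-- payment, as a function of the report -/
  m : unitInterval → ℝ

/-- The direct mechanisms that are individually rational and incentive compatible. -/
def feasibleMechanisms : Set Mechanism :=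
  {M | (∀ v, 0 ≤ M.q v ∧ M.q v ≤ 1) ∧
    (∀ v : unitInterval, 0 ≤ M.q v * v - M.m v) ∧
    (∀ v w : unitInterval, M.q w * v - M.m w ≤ M.q v * v - M.m v)}

/-- The posted price mechanism with deterministic price `p`. -/
def postedPrice (p : unitInterval) : Mechanism where
  q v := if p ≤ v then 1 else 0
  m v := if p ≤ v then (p : ℝ) else 0

/-- The randomized price mechanism whose price is drawn from the distribution `Q`. -/
def randomizedPrice (Q : ProbabilityMeasure unitInterval) : Mechanism where
  q v := ∫ p : unitInterval, (if p ≤ v then (1 : ℝ) else 0) ∂(Q : Measure unitInterval)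
  m v := ∫ p : unitInterval, (if p ≤ v then (p : ℝ) else 0) ∂(Q : Measure unitInterval)

/-- The mean of a price drawn from the distribution `Q`. -/
def meanPrice (Q : ProbabilityMeasure unitInterval) : ℝ :=
  ∫ p : unitInterval, (p : ℝ) ∂(Q : Measure unitInterval)

/-- The expected revenue `𝔼_P[m(v)]`. -/
def revenue (M : Mechanism) (P : Valuation) : ℝ :=
  ∫ v, M.m v ∂(P : Measure unitInterval)

/-- The worst-case expected revenue `inf_{P ∈ 𝒲(P₀, r)} 𝔼_P[m(v)]`. -/
def worstCaseRevenue (P₀ : Valuation) (r : ℝ) (M : Mechanism) : ℝ :=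
  ⨅ P : ambiguitySet P₀ r, revenue M P

/-- The maximum worst-case revenue `Π*_RO(r)`, the supremum over all feasible mechanisms. -/
def maxWorstCaseRevenue (P₀ : Valuation) (r : ℝ) : ℝ :=
  ⨆ M : feasibleMechanisms, worstCaseRevenue P₀ r M

/-- `M` is an optimal mechanism in the robust optimization (RO) framework. -/
def IsOptimalRO (P₀ : Valuation) (r : ℝ) (M : Mechanism) : Prop :=
  M ∈ feasibleMechanisms ∧ worstCaseRevenue P₀ r M = maxWorstCaseRevenue P₀ r

/-- `p` is an optimal posted price in the RO framework. -/
def IsOptimalPriceRO (P₀ : Valuation) (r : ℝ) (p : unitInterval) : Prop :=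
  ∀ p' : unitInterval,
    worstCaseRevenue P₀ r (postedPrice p') ≤ worstCaseRevenue P₀ r (postedPrice p)

/-- The satisficing constraint with target `τ` and fragility `k > 0`. -/
def Satisfices (P₀ : Valuation) (τ : ℝ) (M : Mechanism) (k : ℝ) : Prop :=
  0 < k ∧ ∀ P : Valuation, τ - revenue M P ≤ k * wasserstein P P₀

/-- `M` is an optimal mechanism in the robust satisficing (RS) framework: with some fragility
`k` it attains the minimum of the fragility over all feasible mechanisms. -/
def IsOptimalRS (P₀ : Valuation) (τ : ℝ) (M : Mechanism) : Prop :=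
  M ∈ feasibleMechanisms ∧ ∃ k, Satisfices P₀ τ M k ∧
    ∀ M' ∈ feasibleMechanisms, ∀ k', Satisfices P₀ τ M' k' → k ≤ k'

/-- `p` is an optimal posted price in the RS framework: with some fragility `k` it attains the
minimum of the fragility over all posted prices in `[0,1]`. -/
def IsOptimalPriceRS (P₀ : Valuation) (τ : ℝ) (p : unitInterval) : Prop :=
  ∃ k, Satisfices P₀ τ (postedPrice p) k ∧
    ∀ p' k', Satisfices P₀ τ (postedPrice p') k' → k ≤ k'

end RobustPricing

end

/-! Write `r = hyperbolaCost t` with `0 < t < 1/2` and cap the uniform tail `1 - x` by the hyperbola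
`t(1-t)/x`. This law lies at distance `r`, and no posted price earns more than `t(1-t)` on it, hence
no mechanism does (`revenue_le_of_tail`). Conversely, a price with density proportional to `1/x` on
`[t, 1-t]` turns revenue into an area under the tail, which drops by at most the transport distance;
it guarantees `t(1-t)`. So `τ = t(1-t)`. The same pair of bounds, at another `t₁` with `2τ ·
logRatio t₁ = 1 - 2t₁`, solves RS with fragility `1 / logRatio t₁`.

Optimal price laws need not be identified: only their means matter. On the laws `hyperbolaLaw A B`,
revenue is bounded by an affine function of the mean price, so perturbing the worst case inside this
family yields a first-order condition that determines the mean. For RO it is the logarithmic mean of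
`t` and `1-t`; for RS it is `2τ`, their harmonic mean.

Against a posted price, nature pools the valuations just above it at a point just below, at
quadratic cost. This gives `(1 - √(2r))/2` for RO and `2τ` for RS. The strict inequalities follow
from logarithmic > geometric > harmonic mean: the posted RO price guarantees its own square, so it
is at most `√τ`. -/

noncomputable section

namespace RobustPricing

open MeasureTheory Set Filter Topology

/-! ### Tail probabilities -/

/-- The probability `ℙ(x ≤ v)` of a sale at price `x`. -/
def tail (P : Valuation) (x : ℝ) : ℝ :=
  (P : Measure unitInterval).real {v | x ≤ (v : ℝ)}

lemma measurableSet_le_coe (x : ℝ) : MeasurableSet {v : unitInterval | x ≤ (v : ℝ)} :=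
  measurableSet_le measurable_const measurable_subtype_coe

lemma measurableSet_lt_coe (x : ℝ) : MeasurableSet {v : unitInterval | x < (v : ℝ)} :=
  measurableSet_lt measurable_const measurable_subtype_coe

lemma tail_nonneg (P : Valuation) (x : ℝ) : 0 ≤ tail P x := measureReal_nonneg

lemma tail_le_one (P : Valuation) (x : ℝ) : tail P x ≤ 1 := measureReal_le_one

lemma tail_antitone (P : Valuation) : Antitone (tail P) := fun _ _ h =>
  measureReal_mono fun _ hv => h.trans hv

lemma ccdf_antitone (P : Valuation) : Antitone (ccdf P) := fun _ _ h =>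
  measureReal_mono fun _ hv => lt_of_le_of_lt h hv

lemma ccdf_le_tail (P : Valuation) {x y : ℝ} (h : y ≤ x) : ccdf P x ≤ tail P y :=
  measureReal_mono fun _ hv => h.trans (le_of_lt hv)

lemma uniform_real_lt {x : ℝ} (h0 : 0 ≤ x) (h1 : x ≤ 1) :
    (uniform : Measure unitInterval).real {v | x < (v : ℝ)} = 1 - x := by
  have : {v : unitInterval | x < (v : ℝ)} = Ioi (⟨x, h0, h1⟩ : unitInterval) := by
    ext v; exact Iff.rfl
  rw [this, measureReal_def, uniform, ProbabilityMeasure.coe_mk, unitInterval.volume_Ioi,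
    ENNReal.toReal_ofReal (by simpa using h1)]

lemma uniform_real_le {x : ℝ} (h0 : 0 ≤ x) (h1 : x ≤ 1) :
    (uniform : Measure unitInterval).real {v | x ≤ (v : ℝ)} = 1 - x := by
  have : {v : unitInterval | x ≤ (v : ℝ)} = Ici (⟨x, h0, h1⟩ : unitInterval) := by
    ext v; exact Iff.rfl
  rw [this, measureReal_def, uniform, ProbabilityMeasure.coe_mk, unitInterval.volume_Ici,
    ENNReal.toReal_ofReal (by simpa using h1)]

lemma ccdf_uniform {x : ℝ} (h0 : 0 ≤ x) (h1 : x ≤ 1) : ccdf uniform x = 1 - x :=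
  uniform_real_lt h0 h1

lemma intervalIntegrable_ccdf (P : Valuation) (a b : ℝ) :
    IntervalIntegrable (ccdf P) volume a b := (ccdf_antitone P).intervalIntegrable

lemma intervalIntegrable_abs_ccdf_sub (P P₀ : Valuation) (a b : ℝ) :
    IntervalIntegrable (fun x => |ccdf P x - ccdf P₀ x|) volume a b :=
  ((intervalIntegrable_ccdf P a b).sub (intervalIntegrable_ccdf P₀ a b)).abs

lemma wasserstein_nonneg (P P₀ : Valuation) : 0 ≤ wasserstein P P₀ :=
  intervalIntegral.integral_nonneg zero_le_one fun _ _ => abs_nonneg _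

lemma wasserstein_self (P : Valuation) : wasserstein P P = 0 := by simp [wasserstein]

/-- Integrals of the complementary distribution function over a subinterval move by at most the
Wasserstein distance. -/
lemma integral_ccdf_ge (P : Valuation) {a b : ℝ} (ha : 0 ≤ a) (hab : a ≤ b) (hb : b ≤ 1) :
    (b - a) - (b ^ 2 - a ^ 2) / 2 - wasserstein P uniform ≤ ∫ x in a..b, ccdf P x := by
  have h1 : ∫ x in a..b, |ccdf P x - ccdf uniform x| ≤ wasserstein P uniform :=
    intervalIntegral.integral_mono_interval ha hab hb
      (Filter.Eventually.of_forall fun _ => abs_nonneg _) (intervalIntegrable_abs_ccdf_sub _ _ _ _)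
  have h2 : ∫ x in a..b, ((1 - x) - |ccdf P x - ccdf uniform x|) ≤ ∫ x in a..b, ccdf P x := by
    refine intervalIntegral.integral_mono_on hab ?_ (intervalIntegrable_ccdf _ _ _) fun x hx => ?_
    · exact (Continuous.intervalIntegrable (by fun_prop) _ _).sub
        (intervalIntegrable_abs_ccdf_sub _ _ _ _)
    · rw [ccdf_uniform (ha.trans hx.1) (hx.2.trans hb)]
      linarith [neg_abs_le (ccdf P x - (1 - x))]
  rw [intervalIntegral.integral_sub (Continuous.intervalIntegrable (by fun_prop) _ _)
    (intervalIntegrable_abs_ccdf_sub _ _ _ _), intervalIntegral.integral_sub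
    (by simp) (by simp)] at h2
  simp only [intervalIntegral.integral_const, smul_eq_mul, mul_one, integral_id] at h2
  linarith

/-- A sale probability at `p` below `1 - p` costs nature a quadratic amount of transport. -/
lemma sq_le_wasserstein (P : Valuation) {p : ℝ} (h0 : 0 ≤ p) (h : tail P p ≤ 1 - p) :
    (1 - p - tail P p) ^ 2 / 2 ≤ wasserstein P uniform := by
  have hβ := tail_nonneg P p
  -- The right end is where `1 - x` meets the level `tail P p`; the gap is at least the triangle
  -- between them.
  have h1 := integral_ccdf_ge P h0 (b := 1 - tail P p) (by linarith) (by linarith)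
  have h2 : ∫ x in p..(1 - tail P p), ccdf P x ≤ ∫ x in p..(1 - tail P p), tail P p :=
    intervalIntegral.integral_mono_on (by linarith) (intervalIntegrable_ccdf _ _ _) (by simp)
      fun x hx => ccdf_le_tail P hx.1
  simp only [intervalIntegral.integral_const, smul_eq_mul] at h2
  nlinarith

/-! ### Revenue -/

lemma coe_postedPrice_m (p : unitInterval) : (postedPrice p).m =
    {v : unitInterval | (p : ℝ) ≤ v}.indicator fun _ => (p : ℝ) := by
  ext v
  simp only [postedPrice, indicator, mem_ofPred_eq, Subtype.coe_le_coe]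

lemma revenue_postedPrice (p : unitInterval) (P : Valuation) :
    revenue (postedPrice p) P = p * tail P p := by
  rw [revenue, coe_postedPrice_m, integral_indicator (measurableSet_le_coe _)]
  simp [tail, mul_comm]

lemma measurable_sale : Measurable fun z : unitInterval × unitInterval =>
    if z.2 ≤ z.1 then (z.2 : ℝ) else 0 :=
  Measurable.ite (measurableSet_le measurable_snd measurable_fst)
    (measurable_subtype_coe.comp measurable_snd) measurable_const

lemma revenue_randomizedPrice (Q : ProbabilityMeasure unitInterval) (P : Valuation) :
    revenue (randomizedPrice Q) P = ∫ p : unitInterval, p * tail P p ∂(Q : Measure unitInterval) := by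
  have hint : Integrable (Function.uncurry fun v p : unitInterval => if p ≤ v then (p : ℝ) else 0)
      ((P : Measure unitInterval).prod (Q : Measure unitInterval)) := by
    refine Integrable.of_bound measurable_sale.aestronglyMeasurable 1
      (Filter.Eventually.of_forall fun z => ?_)
    simp only [Function.uncurry, Real.norm_eq_abs]
    split_ifs
    · rw [abs_of_nonneg z.2.2.1]; exact z.2.2.2
    · simp
  have := integral_integral_swap hint
  simp only [revenue, randomizedPrice]
  rw [this]
  congr 1; ext p
  exact revenue_postedPrice p P

lemma measurable_mul_tail (P : Valuation) :
    Measurable fun p : unitInterval => (p : ℝ) * tail P p :=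
  measurable_subtype_coe.mul ((tail_antitone P).measurable.comp measurable_subtype_coe)

lemma integrable_coe (Q : ProbabilityMeasure unitInterval) :
    Integrable (fun p : unitInterval => (p : ℝ)) (Q : Measure unitInterval) :=
  Integrable.of_bound measurable_subtype_coe.aestronglyMeasurable 1
    (Filter.Eventually.of_forall fun p => by rw [Real.norm_eq_abs, abs_of_nonneg p.2.1]; exact p.2.2)

lemma integrable_mul_tail (Q : ProbabilityMeasure unitInterval) (P : Valuation) :
    Integrable (fun p : unitInterval => (p : ℝ) * tail P p) (Q : Measure unitInterval) :=
  Integrable.of_bound (measurable_mul_tail P).aestronglyMeasurable 1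
    (Filter.Eventually.of_forall fun p => by
      rw [Real.norm_eq_abs, abs_of_nonneg (mul_nonneg p.2.1 (tail_nonneg _ _))]
      exact mul_le_one₀ p.2.2 (tail_nonneg _ _) (tail_le_one _ _))

/-- An affine bound in the price survives averaging and then sees `Q` only through its mean. -/
lemma revenue_randomizedPrice_le {P : Valuation} {a b : ℝ}
    (h : ∀ p : unitInterval, (p : ℝ) * tail P p ≤ a + b * p) (Q : ProbabilityMeasure unitInterval) :
    revenue (randomizedPrice Q) P ≤ a + b * meanPrice Q := by
  rw [revenue_randomizedPrice, meanPrice, ← integral_const_mul]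
  have h1 : a = ∫ _ : unitInterval, a ∂(Q : Measure unitInterval) := by simp
  conv_rhs => rw [h1]
  rw [← integral_add (integrable_const _) ((integrable_coe Q).const_mul b)]
  exact integral_mono (integrable_mul_tail Q P)
    ((integrable_const _).add ((integrable_coe Q).const_mul b)) h

/-! ### Feasible mechanisms -/

lemma postedPrice_mem (p : unitInterval) : postedPrice p ∈ feasibleMechanisms := by
  refine ⟨fun v => ?_, fun v => ?_, fun v w => ?_⟩ <;> simp only [postedPrice]
  · split_ifs <;> norm_num
  · split_ifs with h
    · have : (p : ℝ) ≤ v := h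
      linarith
    · simp
  · split_ifs with h h' h'
    · rfl
    · have : (v : ℝ) < p := not_le.1 h'
      linarith
    · have : (p : ℝ) ≤ v := h'
      linarith
    · rfl

lemma integrable_posted_q (Q : ProbabilityMeasure unitInterval) (v : unitInterval) :
    Integrable (fun p : unitInterval => (if p ≤ v then (1 : ℝ) else 0)) (Q : Measure unitInterval) :=
  Integrable.of_bound (Measurable.ite measurableSet_Iic measurable_const
    measurable_const).aestronglyMeasurable 1
    (Filter.Eventually.of_forall fun p => by split_ifs <;> simp)

lemma integrable_posted_m (Q : ProbabilityMeasure unitInterval) (v : unitInterval) :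
    Integrable (fun p : unitInterval => (if p ≤ v then (p : ℝ) else 0)) (Q : Measure unitInterval) :=
  Integrable.of_bound (Measurable.ite measurableSet_Iic measurable_subtype_coe
    measurable_const).aestronglyMeasurable 1
    (Filter.Eventually.of_forall fun p => by
      split_ifs
      · rw [Real.norm_eq_abs, abs_of_nonneg p.2.1]; exact p.2.2
      · simp)

lemma randomizedPrice_mem (Q : ProbabilityMeasure unitInterval) :
    randomizedPrice Q ∈ feasibleMechanisms := by
  have hu : ∀ v w : unitInterval, (randomizedPrice Q).q w * v - (randomizedPrice Q).m w =
      ∫ p : unitInterval, ((postedPrice p).q w * v - (postedPrice p).m w)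
        ∂(Q : Measure unitInterval) := fun v w => by
    simp only [randomizedPrice, postedPrice]
    rw [← integral_mul_const, integral_sub ((integrable_posted_q Q w).mul_const _)
      (integrable_posted_m Q w)]
  have hi : ∀ v w : unitInterval, Integrable
      (fun p : unitInterval => (postedPrice p).q w * v - (postedPrice p).m w)
        (Q : Measure unitInterval) := fun v w =>
    ((integrable_posted_q Q w).mul_const _).sub (integrable_posted_m Q w)
  refine ⟨fun v => ⟨?_, ?_⟩, fun v => ?_, fun v w => ?_⟩
  · exact integral_nonneg fun p => ((postedPrice_mem p).1 v).1
  · calc (randomizedPrice Q).q v ≤ ∫ _ : unitInterval, (1 : ℝ) ∂(Q : Measure unitInterval) :=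
          integral_mono (integrable_posted_q Q v) (integrable_const _)
            fun p => ((postedPrice_mem p).1 v).2
      _ = 1 := by simp
  · rw [hu]
    exact integral_nonneg fun p => (postedPrice_mem p).2.1 v
  · rw [hu, hu]
    exact integral_mono (hi _ _) (hi _ _) fun p => (postedPrice_mem p).2.2 v w

namespace feasibleMechanisms

variable {M : Mechanism}

lemma q_mono (hM : M ∈ feasibleMechanisms) : Monotone M.q := fun v w h => by
  rcases h.eq_or_lt with rfl | h
  · rfl
  have h1 := hM.2.2 v w
  have h2 := hM.2.2 w v
  have h3 : (v : ℝ) < w := h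
  by_contra! h4
  nlinarith

lemma m_mono (hM : M ∈ feasibleMechanisms) : Monotone M.m := fun v w h => by
  have h1 := hM.2.2 v w
  have h2 := mul_nonneg (sub_nonneg.2 (q_mono hM h)) v.2.1
  linarith

lemma m_le (hM : M ∈ feasibleMechanisms) (v : unitInterval) : M.m v ≤ M.q v * v := by
  linarith [hM.2.1 v]

lemma m_zero_le (hM : M ∈ feasibleMechanisms) : M.m 0 ≤ 0 := by
  simpa using m_le hM 0

lemma m_le_one (hM : M ∈ feasibleMechanisms) (v : unitInterval) : M.m v ≤ 1 :=
  (m_le hM v).trans (mul_le_one₀ (hM.1 v).2 v.2.1 v.2.2)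

lemma integrable_m (hM : M ∈ feasibleMechanisms) (P : Valuation) :
    Integrable M.m (P : Measure unitInterval) := by
  -- Feasibility permits subsidies, so `M.m 0` may be negative and enters the bound.
  refine Integrable.of_bound (m_mono hM).measurable.aestronglyMeasurable (max 1 (-M.m 0))
    (Filter.Eventually.of_forall fun v => ?_)
  rw [Real.norm_eq_abs, abs_le]
  have h1 := m_mono hM (unitInterval.nonneg' : 0 ≤ v)
  have h2 := m_le_one hM v
  exact ⟨by linarith [le_max_right 1 (-M.m 0)], h2.trans (le_max_left _ _)⟩

lemma m_zero_le_revenue (hM : M ∈ feasibleMechanisms) (P : Valuation) :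
    M.m 0 ≤ revenue M P := by
  have := integral_mono (integrable_const (M.m 0)) (integrable_m hM P)
    fun v => m_mono hM (unitInterval.nonneg' : 0 ≤ v)
  simpa [revenue] using this

/-- A valuation whose posted-price revenues are all at most `ρ` leaves at most `ρ` to any feasible
mechanism. -/
lemma revenue_le_of_tail (hM : M ∈ feasibleMechanisms) {P : Valuation} {ρ : ℝ}
    (h : ∀ p : unitInterval, (p : ℝ) * tail P p ≤ ρ) : revenue M P ≤ ρ := by
  refine le_of_forall_pos_le_add fun ε hε => ?_
  obtain ⟨n, hn⟩ := exists_nat_one_div_lt hε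
  set N : ℕ := n + 1 with hN
  have hN0 : (0 : ℝ) < N := by rw [hN]; positivity
  have hNε : 1 / (N : ℝ) < ε := by rw [hN]; push_cast; exact hn
  -- Discretise `q` on a grid of mesh `1/N`: its jumps `c i` act as weights of a mixture of posted
  -- prices, up to an error of `1/N` per price.
  set g : ℕ → unitInterval := fun i => projIcc 0 1 zero_le_one ((i : ℝ) / N) with hg
  have hgv : ∀ i ≤ N, (g i : ℝ) = i / N := fun i hi => by
    simp only [hg]
    rw [projIcc_of_mem zero_le_one
      ⟨by positivity, (div_le_one hN0).2 (by exact_mod_cast hi)⟩]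
  have hg0 : g 0 = 0 := Subtype.ext (by rw [hgv 0 (Nat.zero_le _)]; simp)
  have hgm : Monotone g := fun i j hij => by
    refine monotone_projIcc _ ?_
    have : (i : ℝ) ≤ j := by exact_mod_cast hij
    gcongr
  set c : ℕ → ℝ := fun i => M.q (g (i + 1)) - M.q (g i) with hc
  have hc0 : ∀ i, 0 ≤ c i := fun i => sub_nonneg.2 (q_mono hM (hgm (Nat.le_succ i)))
  have hpt : ∀ v : unitInterval, M.m v ≤ ∑ i ∈ Finset.range N,
      {v : unitInterval | (g i : ℝ) < v}.indicator (fun _ => c i * g (i + 1)) v := by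
    intro v
    set j := ⌈(v : ℝ) * N⌉₊ with hj
    have hjN : j ≤ N := Nat.ceil_le.2 (mul_le_of_le_one_left hN0.le v.2.2)
    have hvj : v ≤ g j := by
      refine Subtype.coe_le_coe.1 ?_
      rw [hgv j hjN, le_div_iff₀ hN0]
      exact Nat.le_ceil _
    -- Incentive compatibility between neighbouring grid reports bounds each payment increment by `c
    -- i * g (i + 1)`.
    have htel : ∀ k : ℕ, M.m (g k) ≤ ∑ i ∈ Finset.range k, c i * g (i + 1) := by
      intro k
      induction k with
      | zero => simpa [hg0] using m_zero_le hM
      | succ k ih =>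
        rw [Finset.sum_range_succ]
        have := hM.2.2 (g (k + 1)) (g k)
        simp only [hc] at ih ⊢
        linarith
    calc M.m v ≤ M.m (g j) := m_mono hM hvj
      _ ≤ ∑ i ∈ Finset.range j, c i * g (i + 1) := htel j
      _ = ∑ i ∈ Finset.range j,
          {v : unitInterval | (g i : ℝ) < v}.indicator (fun _ => c i * (g (i + 1) : ℝ)) v := by
        refine Finset.sum_congr rfl fun i hi => ?_
        rw [indicator_of_mem]
        have hij := Finset.mem_range.1 hi
        rw [mem_ofPred_eq, hgv i (hij.le.trans hjN), div_lt_iff₀ hN0]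
        exact Nat.lt_ceil.1 hij
      _ ≤ _ := Finset.sum_le_sum_of_subset_of_nonneg (Finset.range_mono hjN) fun i _ _ =>
        indicator_nonneg (fun _ _ => mul_nonneg (hc0 i) (g (i + 1)).2.1) _
  have hcsum : ∑ i ∈ Finset.range N, c i ≤ 1 := by
    rw [hc, Finset.sum_range_sub fun i => M.q (g i)]
    linarith [(hM.1 (g N)).2, (hM.1 (g 0)).1]
  have hρ : 0 ≤ ρ := by simpa using h 0
  calc revenue M P ≤ ∫ v, ∑ i ∈ Finset.range N,
        {v : unitInterval | (g i : ℝ) < v}.indicator (fun _ => c i * (g (i + 1) : ℝ)) v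
          ∂(P : Measure unitInterval) :=
        integral_mono (integrable_m hM P) (integrable_finsetSum _ fun i _ =>
          (integrable_const _).indicator (measurableSet_lt_coe _)) hpt
    _ = ∑ i ∈ Finset.range N, c i * (g (i + 1) * ccdf P (g i)) := by
        rw [integral_finsetSum _ fun i _ => (integrable_const _).indicator (measurableSet_lt_coe _)]
        refine Finset.sum_congr rfl fun i _ => ?_
        rw [integral_indicator (measurableSet_lt_coe _)]
        simp [ccdf]; ring
    _ ≤ ∑ i ∈ Finset.range N, c i * (ρ + 1 / N) := by
        -- The price is `g (i + 1)` but the sale starts above `g i`; the mismatch costs at most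
        -- `1/N`.
        refine Finset.sum_le_sum fun i hi => mul_le_mul_of_nonneg_left ?_ (hc0 i)
        have hi := Finset.mem_range.1 hi
        have h1 : (g (i + 1) : ℝ) = g i + 1 / N := by
          rw [hgv _ hi, hgv _ hi.le]; push_cast; ring
        have h2 := h (g i)
        have h3 := ccdf_le_tail P (le_refl (g i : ℝ))
        have h4 := tail_le_one P (g i)
        have h5 : 0 < 1 / (N : ℝ) := by positivity
        rw [h1]
        nlinarith [(g i).2.1, mul_le_mul_of_nonneg_left h3 (g i).2.1]
    _ = (∑ i ∈ Finset.range N, c i) * (ρ + 1 / N) := by rw [Finset.sum_mul]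
    _ ≤ 1 * (ρ + 1 / N) := mul_le_mul_of_nonneg_right hcsum (by positivity)
    _ ≤ ρ + ε := by linarith

end feasibleMechanisms

/-! ### Worst-case revenue -/

lemma bddBelow_revenue {M : Mechanism} (hM : M ∈ feasibleMechanisms) (P₀ : Valuation) (r : ℝ) :
    BddBelow (range fun P : ambiguitySet P₀ r => revenue M P) :=
  ⟨M.m 0, by rintro _ ⟨P, rfl⟩; exact feasibleMechanisms.m_zero_le_revenue hM _⟩

lemma worstCaseRevenue_le {M : Mechanism} (hM : M ∈ feasibleMechanisms) {P P₀ : Valuation} {r : ℝ}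
    (hP : wasserstein P P₀ ≤ r) : worstCaseRevenue P₀ r M ≤ revenue M P :=
  ciInf_le (bddBelow_revenue hM P₀ r) (⟨P, hP⟩ : ambiguitySet P₀ r)

lemma le_worstCaseRevenue {M : Mechanism} {P₀ : Valuation} {r a : ℝ} (hr : 0 ≤ r)
    (h : ∀ P, wasserstein P P₀ ≤ r → a ≤ revenue M P) : a ≤ worstCaseRevenue P₀ r M := by
  have : Nonempty (ambiguitySet P₀ r) := ⟨⟨P₀, by simpa [ambiguitySet, wasserstein_self] using hr⟩⟩
  exact le_ciInf fun P => h P P.2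

/-! ### Laws obtained by transporting the uniform distribution -/

/-- The law of `T u` for `u` uniform. -/
def transportLaw (T : unitInterval → unitInterval) (hT : Measurable T) : Valuation :=
  uniform.map hT.aemeasurable

lemma tail_transportLaw {T : unitInterval → unitInterval} (hT : Measurable T) (x : ℝ) :
    tail (transportLaw T hT) x = (uniform : Measure unitInterval).real {u | x ≤ (T u : ℝ)} := by
  rw [tail, transportLaw, ProbabilityMeasure.toMeasure_map,
    map_measureReal_apply hT (measurableSet_le_coe x)]
  rfl

lemma ccdf_transportLaw {T : unitInterval → unitInterval} (hT : Measurable T) (x : ℝ) :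
    ccdf (transportLaw T hT) x = (uniform : Measure unitInterval).real {u | x < (T u : ℝ)} := by
  rw [ccdf, transportLaw, ProbabilityMeasure.toMeasure_map,
    map_measureReal_apply hT (measurableSet_lt_coe x)]
  rfl

/-- For laws that only lower valuations within `[a, b]`, the distance is the removed area `g`,
without absolute value. -/
lemma wasserstein_uniform_eq (P : Valuation) {a b : ℝ} {g : ℝ → ℝ} (ha : 0 ≤ a) (hab : a ≤ b)
    (hb : b ≤ 1) (h1 : ∀ x ∈ Ioo 0 a, ccdf P x = 1 - x) (h3 : ∀ x ∈ Ioo b 1, ccdf P x = 1 - x)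
    (h2 : ∀ x ∈ Ioo a b, ccdf P x = 1 - x - g x) (hg : ∀ x ∈ Ioo a b, 0 ≤ g x) :
    wasserstein P uniform = ∫ x in a..b, g x := by
  have hi := intervalIntegrable_abs_ccdf_sub P uniform
  rw [wasserstein, ← intervalIntegral.integral_add_adjacent_intervals (hi 0 b) (hi b 1),
    ← intervalIntegral.integral_add_adjacent_intervals (hi 0 a) (hi a b),
    intervalIntegral.integral_congr_Ioo_of_le ha (g := fun _ => 0),
    intervalIntegral.integral_congr_Ioo_of_le hb (g := fun _ => 0),
    intervalIntegral.integral_congr_Ioo_of_le hab (g := g)]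
  · simp
  · intro x hx
    beta_reduce
    rw [h2 x hx, ccdf_uniform (ha.trans hx.1.le) (hx.2.le.trans hb), sub_sub_cancel_left, abs_neg,
      abs_of_nonneg (hg x hx)]
  · intro x hx
    beta_reduce
    rw [h3 x hx, ccdf_uniform ((ha.trans hab).trans hx.1.le) hx.2.le]; simp
  · intro x hx
    beta_reduce
    rw [h1 x hx, ccdf_uniform hx.1.le (hx.2.le.trans (hab.trans hb))]; simp

/-- The map pooling `(c, e]` at `c`. -/
def poolMap (c e u : unitInterval) : unitInterval := if c < u ∧ u ≤ e then c else u

lemma measurable_poolMap (c e : unitInterval) : Measurable (poolMap c e) :=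
  Measurable.ite measurableSet_Ioc measurable_const measurable_id

/-- The uniform law with the mass of `(c, e]` moved to `c`. -/
def poolLaw (c e : unitInterval) : Valuation := transportLaw _ (measurable_poolMap c e)

lemma lt_poolMap_of_notMem {c e : unitInterval} {x : ℝ} (hx : x ∉ Ico (c : ℝ) e) (u : unitInterval) :
    x < poolMap c e u ↔ x < u := by
  unfold poolMap
  split_ifs with h
  · have h1 : (c : ℝ) < u := h.1
    have h2 : (u : ℝ) ≤ e := h.2
    rw [mem_Ico, not_and_or, not_le, not_lt] at hx
    rcases hx with hx | hx
    · exact ⟨fun h => h.trans h1, fun _ => hx⟩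
    · exact ⟨fun h => h.trans h1, fun h => absurd (h.trans_le h2) hx.not_gt⟩
  · rfl

lemma lt_poolMap_of_mem {c e : unitInterval} {x : ℝ} (hx : x ∈ Ico (c : ℝ) e) (u : unitInterval) :
    x < poolMap c e u ↔ e < (u : ℝ) := by
  unfold poolMap
  split_ifs with h
  · have h2 : (u : ℝ) ≤ e := h.2
    exact ⟨fun h => absurd h hx.1.not_gt, fun h => absurd h h2.not_gt⟩
  · rw [not_and_or, not_lt, not_le] at h
    rcases h with h | h
    · have h : (u : ℝ) ≤ c := h
      exact ⟨fun h' => by linarith [hx.1], fun h' => by linarith [hx.1, hx.2]⟩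
    · exact ⟨fun _ => h, fun h' => hx.2.trans h'⟩

/-- The pooling point must be strictly below `p`: a buyer with valuation exactly `p` still buys. -/
lemma tail_poolLaw {c e : unitInterval} {p : ℝ} (hc : c < p) (he : p ≤ e) :
    tail (poolLaw c e) p = 1 - e := by
  rw [poolLaw, tail_transportLaw, ← uniform_real_lt e.2.1 e.2.2]
  congr 1; ext u
  refine ⟨fun h => ?_, fun h => ?_⟩
  · exact (lt_poolMap_of_mem ⟨le_rfl, hc.trans_le he⟩ u).1 (hc.trans_le h)
  · have h1 : ¬ (c < u ∧ u ≤ e) := fun h' => absurd (Subtype.coe_le_coe.2 h'.2) (not_le.2 h)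
    simp only [mem_ofPred_eq, poolMap, if_neg h1]
    exact he.trans (le_of_lt h)

lemma wasserstein_poolLaw {c e : unitInterval} (h : c ≤ e) :
    wasserstein (poolLaw c e) uniform = ((e : ℝ) - c) ^ 2 / 2 := by
  rw [wasserstein_uniform_eq (poolLaw c e) (a := c) (b := e) (g := fun x => e - x) c.2.1 h e.2.2]
  · rw [intervalIntegral.integral_sub (by simp) (by simp)]
    simp only [intervalIntegral.integral_const, smul_eq_mul, integral_id]
    ring
  · intro x hx
    rw [poolLaw, ccdf_transportLaw, ← uniform_real_lt hx.1.le (hx.2.le.trans c.2.2)]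
    congr 1; ext u
    exact lt_poolMap_of_notMem (fun h => absurd hx.2 h.1.not_gt) u
  · intro x hx
    rw [poolLaw, ccdf_transportLaw, ← uniform_real_lt (e.2.1.trans hx.1.le) hx.2.le]
    congr 1; ext u
    exact lt_poolMap_of_notMem (fun h => absurd hx.1 h.2.not_gt) u
  · intro x hx
    rw [poolLaw, ccdf_transportLaw]
    calc _ = (uniform : Measure unitInterval).real {u | (e : ℝ) < u} := by
          congr 1; ext u
          exact lt_poolMap_of_mem ⟨hx.1.le, hx.2⟩ u
      _ = _ := by rw [uniform_real_lt e.2.1 e.2.2]; ring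
  · exact fun x hx => sub_nonneg.2 hx.2.le

/-- The map lowering `u ∈ (A, B)` to the point where the hyperbola `x ↦ A B / x + 1 - A - B`
takes the value `1 - u`. -/
def hyperbolaMap (A B : ℝ) (u : unitInterval) : unitInterval :=
  projIcc 0 1 zero_le_one (if A < u ∧ (u : ℝ) < B then A * B / (A + B - u) else u)

lemma measurable_hyperbolaMap (A B : ℝ) : Measurable (hyperbolaMap A B) := by
  refine continuous_projIcc.measurable.comp (Measurable.ite ?_ ?_ measurable_subtype_coe)
  · exact (measurableSet_lt measurable_const measurable_subtype_coe).inter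
      (measurableSet_lt measurable_subtype_coe measurable_const)
  · exact measurable_const.div (measurable_const.sub measurable_subtype_coe)

/-- The law with complementary distribution function `min (1 - x) (A B / x + 1 - A - B)`. -/
def hyperbolaLaw (A B : ℝ) : Valuation := transportLaw _ (measurable_hyperbolaMap A B)

lemma coe_hyperbolaMap {A B : ℝ} (hA : 0 < A) (hB : B ≤ 1) (u : unitInterval) :
    (hyperbolaMap A B u : ℝ) = if A < u ∧ (u : ℝ) < B then A * B / (A + B - u) else u := by
  rw [hyperbolaMap, projIcc_of_mem zero_le_one]
  split_ifs with h
  · have h0 : 0 < B := hA.trans (h.1.trans h.2)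
    have h1 : 0 < A + B - u := by linarith [h.2]
    refine ⟨by positivity, (div_le_one h1).2 ?_⟩
    nlinarith [h.1, h.2]
  · exact u.2

/-- Everything rests on `u (A + B - u) - A B = (u - A)(B - u)`: inside `(A, B)` the map lowers `u`,
so the second condition implies the first; outside, the first implies the second. -/
lemma le_hyperbolaMap_iff {A B x : ℝ} (hA : 0 < A) (hAB : A < B) (hB : B ≤ 1) (hx : 0 < x)
    (u : unitInterval) :
    x ≤ hyperbolaMap A B u ↔ x ≤ u ∧ x * (A + B - u) ≤ A * B := by
  rw [coe_hyperbolaMap hA hB]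
  split_ifs with h
  · have h1 : 0 < A + B - u := by linarith [h.2]
    rw [le_div_iff₀ h1]
    refine ⟨fun h2 => ⟨le_of_mul_le_mul_right (h2.trans ?_) h1, h2⟩, And.right⟩
    nlinarith [h.1, h.2]
  · refine ⟨fun h2 => ⟨h2, ?_⟩, And.left⟩
    rw [not_and_or, not_lt, not_lt] at h
    rcases h with h | h
    · nlinarith
    · rcases le_or_gt (A + B - u) 0 with h3 | h3
      · nlinarith [mul_nonneg hx.le (neg_nonneg.2 h3), mul_pos hA (hA.trans hAB)]
      · nlinarith

lemma lt_hyperbolaMap_iff {A B x : ℝ} (hA : 0 < A) (hAB : A < B) (hB : B ≤ 1) (hx : 0 < x)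
    (u : unitInterval) :
    x < hyperbolaMap A B u ↔ x < u ∧ x * (A + B - u) < A * B := by
  rw [coe_hyperbolaMap hA hB]
  split_ifs with h
  · have h1 : 0 < A + B - u := by linarith [h.2]
    rw [lt_div_iff₀ h1]
    refine ⟨fun h2 => ⟨lt_of_mul_lt_mul_right (h2.trans_le ?_) h1.le, h2⟩, And.right⟩
    nlinarith [h.1, h.2]
  · refine ⟨fun h2 => ⟨h2, ?_⟩, And.left⟩
    have hAB' : 0 < A * B := by nlinarith
    rw [not_and_or, not_lt, not_lt] at h
    rcases h with h | h
    · nlinarith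
    · rcases le_or_gt (A + B - u) 0 with h3 | h3
      · nlinarith
      · nlinarith

lemma mul_tail_hyperbolaLaw_le {A B : ℝ} (hA : 0 < A) (hAB : A < B) (hB : B ≤ 1)
    (p : unitInterval) : (p : ℝ) * tail (hyperbolaLaw A B) p ≤ A * B + (1 - (A + B)) * p := by
  have hAB' : 0 < A * B := by nlinarith
  have hp1 := p.2.2
  rcases p.2.1.eq_or_lt with hp | hp
  · rw [← hp]; simpa using hAB'.le
  -- The point that the hyperbolic branch sends to `p`; a sale at `p` requires `u ≥ x`. If `x < 0`,
  -- the bound `tail ≤ 1` suffices.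
  set x : ℝ := A + B - A * B / p with hx
  have hpx : p * x = p * (A + B) - A * B := by rw [hx]; field_simp
  have hx1 : x ≤ 1 := by
    refine le_of_mul_le_mul_left ?_ hp
    nlinarith [mul_nonneg hp.le (mul_nonneg (sub_nonneg.2 (hAB.le.trans hB)) (sub_nonneg.2 hB)),
      mul_nonneg (sub_nonneg.2 hp1) hAB'.le]
  have key : tail (hyperbolaLaw A B) p ≤ 1 - x := by
    rcases le_or_gt 0 x with h0 | h0
    · rw [← uniform_real_le h0 hx1, hyperbolaLaw, tail_transportLaw]
      refine measureReal_mono fun u hu => ?_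
      have := ((le_hyperbolaMap_iff hA hAB hB hp u).1 hu).2
      exact le_of_mul_le_mul_left (by linarith) hp
    · linarith [tail_le_one (hyperbolaLaw A B) p]
  nlinarith

lemma wasserstein_hyperbolaLaw {A B : ℝ} (hA : 0 < A) (hAB : A < B) (hB : B ≤ 1) :
    wasserstein (hyperbolaLaw A B) uniform =
      (B ^ 2 - A ^ 2) / 2 - A * B * Real.log (B / A) := by
  have hB0 := hA.trans hAB
  rw [wasserstein_uniform_eq (hyperbolaLaw A B) (g := fun x => A + B - x - A * B * (1 / x))
    hA.le hAB.le hB]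
  · have h0 : (0 : ℝ) ∉ uIcc A B := by
      rw [uIcc_of_le hAB.le]; exact fun h => absurd h.1 hA.not_ge
    have hi : IntervalIntegrable (fun x : ℝ => A * B * (1 / x)) volume A B :=
      (intervalIntegral.intervalIntegrable_one_div (fun x hx h => h0 (h ▸ hx))
        continuousOn_id).const_mul _
    rw [intervalIntegral.integral_sub (Continuous.intervalIntegrable (by fun_prop) _ _) hi,
      intervalIntegral.integral_sub (by simp) (by simp), intervalIntegral.integral_const_mul,
      integral_one_div h0]
    simp only [intervalIntegral.integral_const, smul_eq_mul, integral_id]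
    ring
  · intro x hx
    rw [hyperbolaLaw, ccdf_transportLaw, ← uniform_real_lt hx.1.le (by linarith [hx.2])]
    congr 1; ext u
    rw [mem_ofPred_eq, lt_hyperbolaMap_iff hA hAB hB hx.1]
    refine ⟨And.left, fun h => ⟨h, ?_⟩⟩
    have h' : x < u := h
    nlinarith [mul_pos (sub_pos.2 hx.2) (sub_pos.2 (hx.2.trans hAB)), hx.1]
  · intro x hx
    have hx0 := hB0.trans hx.1
    rw [hyperbolaLaw, ccdf_transportLaw, ← uniform_real_lt hx0.le hx.2.le]
    congr 1; ext u
    rw [mem_ofPred_eq, lt_hyperbolaMap_iff hA hAB hB hx0]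
    refine ⟨And.left, fun h => ⟨h, ?_⟩⟩
    have h' : x < u := h
    nlinarith [mul_pos (sub_pos.2 hx.1) (sub_pos.2 (hAB.trans hx.1))]
  · intro x hx
    have hx0 := hA.trans hx.1
    have hxy : x * (A + B - A * B * (1 / x)) = x * (A + B) - A * B := by field_simp
    set y : ℝ := A + B - A * B * (1 / x) with hy
    have h1 : x ≤ y := by
      refine le_of_mul_le_mul_left ?_ hx0
      nlinarith [hx.1, hx.2]
    have h2 : y ≤ B := by
      refine le_of_mul_le_mul_left ?_ hx0
      nlinarith [hx.1, hx.2]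
    rw [hyperbolaLaw, ccdf_transportLaw]
    calc _ = (uniform : Measure unitInterval).real {u | y < (u : ℝ)} := by
          congr 1; ext u
          rw [mem_ofPred_eq, lt_hyperbolaMap_iff hA hAB hB hx0]
          refine ⟨fun h => lt_of_mul_lt_mul_left (a := x) (by linarith [h.2]) hx0.le, fun h => ?_⟩
          have h' : y < u := h
          exact ⟨h1.trans_lt h', by nlinarith⟩
      _ = _ := by rw [uniform_real_lt (by linarith) (by linarith), hy]; ring
  · intro x hx
    have hx0 := hA.trans hx.1
    have : A + B - x - A * B * (1 / x) = (x - A) * (B - x) / x := by field_simp; ring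
    rw [this]
    exact div_nonneg (mul_nonneg (by linarith [hx.1]) (by linarith [hx.2])) hx0.le

/-! ### The log-uniform randomized price -/

lemma integral_unitInterval_indicator {A B : ℝ} (hA : 0 ≤ A) (hAB : A ≤ B) (hB : B ≤ 1)
    (f : ℝ → ℝ) :
    ∫ p : unitInterval, (Icc A B).indicator f p = ∫ x in A..B, f x := by
  have h := integral_subtype (α := ℝ) (s := Icc (0 : ℝ) 1) measurableSet_Icc
    ((Icc A B).indicator f)
  rw [show (∫ p : unitInterval, (Icc A B).indicator f p) = _ from h,
    setIntegral_indicator measurableSet_Icc, inter_eq_right.2 (Icc_subset_Icc hA hB),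
    integral_Icc_eq_integral_Ioc, intervalIntegral.integral_of_le hAB]

/-- The price has density `1 / (ℓ x)` on `[A, B]`. The factor `1/x` cancels the price paid, leaving
the integral of the tail divided by `ℓ`. -/
lemma exists_randomizedPrice_revenue_ge {A B : ℝ} (hA : 0 < A) (hAB : A < B) (hB : B ≤ 1) :
    ∃ Q : ProbabilityMeasure unitInterval, ∀ P : Valuation,
      (∫ x in A..B, ccdf P x) / Real.log (B / A) ≤ revenue (randomizedPrice Q) P := by
  set ℓ := Real.log (B / A) with hℓ
  have hℓ0 : 0 < ℓ := Real.log_pos ((one_lt_div hA).2 hAB)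
  have h0 : (0 : ℝ) ∉ uIcc A B := by
    rw [uIcc_of_le hAB.le]; exact fun h => absurd h.1 hA.not_ge
  set g : ℝ → ℝ := (Icc A B).indicator fun x => ℓ⁻¹ * (1 / x) with hg
  have hg0 : ∀ x, 0 ≤ g x := indicator_nonneg fun x hx => by
    have := hA.trans_le hx.1
    positivity
  have hgm : Measurable g := by
    refine Measurable.indicator ?_ measurableSet_Icc
    fun_prop
  have hgm' : Measurable fun p : unitInterval => g p := hgm.comp measurable_subtype_coe
  have hgb : ∀ x, g x ≤ ℓ⁻¹ * (1 / A) := fun x => by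
    refine indicator_apply_le' (fun hx => ?_) fun _ => by positivity
    have := hx.1
    gcongr
  have hgi : Integrable fun p : unitInterval => g p :=
    Integrable.of_bound hgm'.aestronglyMeasurable (ℓ⁻¹ * (1 / A))
      (Filter.Eventually.of_forall fun p => by
        rw [Real.norm_eq_abs, abs_of_nonneg (hg0 _)]; exact hgb _)
  have hg1 : ∫ p : unitInterval, g p = 1 := by
    rw [hg, integral_unitInterval_indicator hA.le hAB.le hB, intervalIntegral.integral_const_mul,
      integral_one_div h0, ← hℓ, inv_mul_cancel₀ hℓ0.ne']
  set ν : Measure unitInterval := volume.withDensity fun p => ENNReal.ofReal (g p) with hν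
  have : IsProbabilityMeasure ν := ⟨by
    rw [hν, withDensity_apply _ MeasurableSet.univ, Measure.restrict_univ,
      ← ofReal_integral_eq_lintegral_ofReal hgi (Filter.Eventually.of_forall fun p => hg0 _), hg1,
      ENNReal.ofReal_one]⟩
  obtain ⟨Q, hQ⟩ : ∃ Q : ProbabilityMeasure unitInterval, (Q : Measure unitInterval) = ν :=
    ⟨⟨ν, this⟩, rfl⟩
  refine ⟨Q, fun P => ?_⟩
  rw [revenue_randomizedPrice, hQ, hν,
    integral_withDensity_eq_integral_toReal_smul hgm'.ennreal_ofReal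
      (Filter.Eventually.of_forall fun _ => ENNReal.ofReal_lt_top)]
  have h2 : ∀ p : unitInterval, (ENNReal.ofReal (g p)).toReal • ((p : ℝ) * tail P p) =
      (Icc A B).indicator (fun x => ℓ⁻¹ * tail P x) p := fun p => by
    rw [ENNReal.toReal_ofReal (hg0 _), smul_eq_mul, hg]
    by_cases hp : (p : ℝ) ∈ Icc A B
    · have := hA.trans_le hp.1
      rw [indicator_of_mem hp, indicator_of_mem hp]
      field_simp
    · rw [indicator_of_notMem hp, indicator_of_notMem hp, zero_mul]
  simp_rw [h2]
  rw [integral_unitInterval_indicator hA.le hAB.le hB, intervalIntegral.integral_const_mul,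
    div_eq_inv_mul]
  refine mul_le_mul_of_nonneg_left ?_ (inv_nonneg.2 hℓ0.le)
  exact intervalIntegral.integral_mono_on hAB.le (intervalIntegrable_ccdf _ _ _)
    (tail_antitone P).intervalIntegrable fun x _ => ccdf_le_tail P le_rfl

/-! ### The transport cost of a symmetric hyperbola -/

/-- The logarithm of the ratio of the endpoints of `[t, 1 - t]`. -/
def logRatio (t : ℝ) : ℝ := Real.log ((1 - t) / t)

/-- The Wasserstein distance of `hyperbolaLaw t (1 - t)` to the uniform law. -/
def hyperbolaCost (t : ℝ) : ℝ := (1 - 2 * t) / 2 - t * (1 - t) * logRatio t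

/-- Scaling both endpoints by `s` makes `A + B = s`. This is the perturbation family: the cost
scales by `s ^ 2`, and the revenue bound acquires the term `(1 - s) * meanPrice Q`. -/
lemma wasserstein_hyperbolaLaw_mul {s t : ℝ} (hs : 0 < s) (ht : 0 < t) (ht' : t < 1 / 2)
    (h : s * (1 - t) ≤ 1) :
    wasserstein (hyperbolaLaw (s * t) (s * (1 - t))) uniform = s ^ 2 * hyperbolaCost t := by
  rw [wasserstein_hyperbolaLaw (by positivity) (by nlinarith) h, mul_div_mul_left _ _ hs.ne',
    hyperbolaCost, logRatio]
  ring

lemma revenue_hyperbolaLaw_mul_le {s t : ℝ} (hs : 0 < s) (ht : 0 < t) (ht' : t < 1 / 2)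
    (h : s * (1 - t) ≤ 1) (Q : ProbabilityMeasure unitInterval) :
    revenue (randomizedPrice Q) (hyperbolaLaw (s * t) (s * (1 - t))) ≤
      s ^ 2 * (t * (1 - t)) + (1 - s) * meanPrice Q := by
  refine (revenue_randomizedPrice_le
    (mul_tail_hyperbolaLaw_le (by positivity) (by nlinarith) h) Q).trans_eq ?_
  ring

lemma wasserstein_hyperbolaLaw_symm {t : ℝ} (ht : 0 < t) (ht' : t < 1 / 2) :
    wasserstein (hyperbolaLaw t (1 - t)) uniform = hyperbolaCost t := by
  simpa using wasserstein_hyperbolaLaw_mul one_pos ht ht' (by linarith)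

lemma revenue_hyperbolaLaw_symm_le {t : ℝ} (ht : 0 < t) (ht' : t < 1 / 2) {M : Mechanism}
    (hM : M ∈ feasibleMechanisms) : revenue M (hyperbolaLaw t (1 - t)) ≤ t * (1 - t) :=
  feasibleMechanisms.revenue_le_of_tail hM fun p =>
    (mul_tail_hyperbolaLaw_le ht (by linarith) (by linarith) p).trans_eq (by ring)

lemma exists_randomizedPrice_revenue_ge_symm {t : ℝ} (ht : 0 < t) (ht' : t < 1 / 2) :
    ∃ Q : ProbabilityMeasure unitInterval, ∀ P : Valuation,
      ((1 - 2 * t) / 2 - wasserstein P uniform) / logRatio t ≤ revenue (randomizedPrice Q) P := by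
  obtain ⟨Q, hQ⟩ := exists_randomizedPrice_revenue_ge ht (B := 1 - t) (by linarith) (by linarith)
  refine ⟨Q, fun P => le_trans ?_ (hQ P)⟩
  have h := integral_ccdf_ge P ht.le (b := 1 - t) (by linarith) (by linarith)
  have hL : 0 ≤ Real.log ((1 - t) / t) := Real.log_nonneg ((one_le_div ht).2 (by linarith))
  refine div_le_div_of_nonneg_right (le_trans (le_of_eq ?_) h) hL
  ring

lemma logRatio_pos {t : ℝ} (ht : 0 < t) (ht' : t < 1 / 2) : 0 < logRatio t :=
  Real.log_pos ((one_lt_div ht).2 (by linarith))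

/-- The logarithmic mean of `t` and `1 - t` exceeds their geometric mean. -/
lemma sqrt_mul_logRatio_lt {t : ℝ} (ht : 0 < t) (ht' : t < 1 / 2) :
    √(t * (1 - t)) * logRatio t < 1 - 2 * t := by
  have h1 : (0 : ℝ) < 1 - t := by linarith
  -- With `y = logRatio t / 2`, the claim is `y < sinh y` multiplied by `2 √(t(1-t))`.
  have h := Real.self_lt_sinh_iff.2 (half_pos (logRatio_pos ht ht'))
  have hx : 0 < √t := Real.sqrt_pos.2 ht
  have hy : 0 < √(1 - t) := Real.sqrt_pos.2 h1
  have he : Real.exp (logRatio t / 2) = √(1 - t) / √t := by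
    rw [logRatio, ← Real.log_sqrt (by positivity), Real.exp_log (Real.sqrt_pos.2 (by positivity)),
      Real.sqrt_div h1.le]
  rw [Real.sinh_eq, Real.exp_neg, he, inv_div] at h
  rw [Real.sqrt_mul ht.le]
  have e1 : √t * √(1 - t) * (√(1 - t) / √t - √t / √(1 - t)) = √(1 - t) ^ 2 - √t ^ 2 := by
    field_simp
  rw [Real.sq_sqrt ht.le, Real.sq_sqrt h1.le] at e1
  nlinarith [mul_pos hx hy]

/-- The logarithmic mean of `t` and `1 - t` exceeds their harmonic mean. -/
lemma two_mul_mul_logRatio_lt {t : ℝ} (ht : 0 < t) (ht' : t < 1 / 2) :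
    2 * (t * (1 - t)) * logRatio t < 1 - 2 * t := by
  have h := sqrt_mul_logRatio_lt ht ht'
  have h0 : 0 < t * (1 - t) := mul_pos ht (by linarith)
  have h1 : √(t * (1 - t)) ≤ 1 / 2 := Real.sqrt_le_iff.2 ⟨by norm_num, by nlinarith⟩
  have h2 := Real.mul_self_sqrt h0.le
  nlinarith [logRatio_pos ht ht', Real.sqrt_nonneg (t * (1 - t)),
    mul_nonneg (mul_nonneg (logRatio_pos ht ht').le (Real.sqrt_nonneg (t * (1 - t))))
      (sub_nonneg.2 h1)]

lemma hyperbolaCost_pos {t : ℝ} (ht : 0 < t) (ht' : t < 1 / 2) : 0 < hyperbolaCost t := by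
  have := two_mul_mul_logRatio_lt ht ht'
  rw [hyperbolaCost]
  linarith

lemma hasDerivAt_logRatio {t : ℝ} (ht : 0 < t) (ht' : t < 1 / 2) :
    HasDerivAt logRatio (-(1 / (t * (1 - t)))) t := by
  have h1 : (1 - t) ≠ 0 := by linarith
  have h := (((hasDerivAt_id t).const_sub 1).div (hasDerivAt_id t) ht.ne').log
    (div_ne_zero h1 ht.ne')
  refine h.congr_deriv ?_
  simp only [id, Pi.div_apply]
  field_simp
  ring

lemma hasDerivAt_hyperbolaCost {t : ℝ} (ht : 0 < t) (ht' : t < 1 / 2) :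
    HasDerivAt hyperbolaCost (-((1 - 2 * t) * logRatio t)) t := by
  have h1 : (1 - t) ≠ 0 := by linarith
  have h := ((((hasDerivAt_id t).const_mul 2).const_sub 1).div_const 2).sub
    (((hasDerivAt_id t).mul ((hasDerivAt_id t).const_sub 1)).mul (hasDerivAt_logRatio ht ht'))
  refine h.congr_deriv ?_
  simp only [id, Pi.mul_apply]
  field_simp
  ring

/-- `negMulLog` extends the cost continuously to `t = 0` with value `1/2`, so intermediate values
cover all of `(0, 1/2)`. -/
lemma exists_hyperbolaCost_eq {r : ℝ} (hr : 0 < r) (hr' : r < 1 / 2) :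
    ∃ t, 0 < t ∧ t < 1 / 2 ∧ hyperbolaCost t = r := by
  set F : ℝ → ℝ := fun t =>
    (1 - 2 * t) / 2 - ((1 - t) * Real.negMulLog t - t * Real.negMulLog (1 - t)) with hF
  have hc : Continuous F := by
    have := Real.continuous_negMulLog
    fun_prop
  have h0 : F 0 = 1 / 2 := by simp [hF]
  have h1 : F (1 / 2) = 0 := by norm_num [hF]
  obtain ⟨t, ht, hFt⟩ := intermediate_value_Icc' (by norm_num : (0 : ℝ) ≤ 1 / 2)
    hc.continuousOn (show r ∈ Icc (F (1 / 2)) (F 0) by rw [h0, h1]; exact ⟨hr.le, hr'.le⟩)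
  have ht0 : 0 < t := ht.1.lt_of_ne fun h => by rw [← h, h0] at hFt; linarith
  have ht1 : t < 1 / 2 := ht.2.lt_of_ne fun h => by rw [h, h1] at hFt; linarith
  refine ⟨t, ht0, ht1, ?_⟩
  rw [← hFt, hyperbolaCost, logRatio, Real.log_div (by linarith) ht0.ne', hF]
  simp only [Real.negMulLog]
  ring

lemma exists_logMean_eq {a t₀ : ℝ} (ha : 0 < a) (ht : 0 < t₀) (ht' : t₀ < 1 / 2)
    (h : a * logRatio t₀ < 1 - 2 * t₀) :
    ∃ t, 0 < t ∧ t < 1 / 2 ∧ a * logRatio t = 1 - 2 * t := by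
  set E := Real.exp (-(1 / a)) with hE
  have hE0 : 0 < E := Real.exp_pos _
  have hE1 : E < 1 := Real.exp_lt_one_iff.2 (by rw [neg_lt_zero]; positivity)
  set u := E / (1 + E) with hu
  -- `u` is the point with `logRatio u = 1/a`, where `1 - 2u - a * logRatio u = -2u < 0`; at `t₀`
  -- the sign is positive.
  have hu0 : 0 < u := by positivity
  have hu1 : u < 1 / 2 := by rw [hu, div_lt_div_iff₀ (by positivity) two_pos]; linarith
  have hLu : logRatio u = 1 / a := by
    have : (1 - u) / u = Real.exp (1 / a) := by
      rw [show Real.exp (1 / a) = E⁻¹ by rw [hE, Real.exp_neg, inv_inv], hu]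
      field_simp
      ring
    rw [logRatio, this, Real.log_exp]
  have hcont : ContinuousOn (fun t => 1 - 2 * t - a * logRatio t) (Ioo 0 (1 / 2)) := fun t ht =>
    ((by fun_prop : ContinuousAt (fun t : ℝ => 1 - 2 * t) t).sub
      ((hasDerivAt_logRatio ht.1 ht.2).continuousAt.const_mul a)).continuousWithinAt
  obtain ⟨t, ht, hft⟩ := isPreconnected_Ioo.intermediate_value
    (show u ∈ Ioo (0 : ℝ) (1 / 2) from ⟨hu0, hu1⟩) (show t₀ ∈ Ioo (0 : ℝ) (1 / 2) from ⟨ht, ht'⟩)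
    hcont (show (0 : ℝ) ∈ Icc _ _ from ⟨by
      rw [hLu, mul_one_div_cancel ha.ne']; linarith, by linarith⟩)
  exact ⟨t, ht.1, ht.2, by linarith [show 1 - 2 * t - a * logRatio t = 0 from hft]⟩

/-! ### Robust optimization over all mechanisms -/

section RobustOptimization

variable {t : ℝ}

lemma worstCaseRevenue_le_symm (ht : 0 < t) (ht' : t < 1 / 2) {M : Mechanism}
    (hM : M ∈ feasibleMechanisms) : worstCaseRevenue uniform (hyperbolaCost t) M ≤ t * (1 - t) :=
  (worstCaseRevenue_le hM (wasserstein_hyperbolaLaw_symm ht ht').le).trans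
    (revenue_hyperbolaLaw_symm_le ht ht' hM)

lemma exists_le_worstCaseRevenue (ht : 0 < t) (ht' : t < 1 / 2) :
    ∃ Q, t * (1 - t) ≤ worstCaseRevenue uniform (hyperbolaCost t) (randomizedPrice Q) := by
  obtain ⟨Q, hQ⟩ := exists_randomizedPrice_revenue_ge_symm ht ht'
  refine ⟨Q, le_worstCaseRevenue (hyperbolaCost_pos ht ht').le fun P hP => le_trans ?_ (hQ P)⟩
  rw [le_div_iff₀ (logRatio_pos ht ht')]
  rw [hyperbolaCost] at hP
  linarith

lemma bddAbove_worstCaseRevenue (ht : 0 < t) (ht' : t < 1 / 2) :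
    BddAbove (range fun M : feasibleMechanisms =>
      worstCaseRevenue uniform (hyperbolaCost t) M) :=
  ⟨t * (1 - t), by rintro _ ⟨M, rfl⟩; exact worstCaseRevenue_le_symm ht ht' M.2⟩

lemma worstCaseRevenue_le_max (ht : 0 < t) (ht' : t < 1 / 2) {M : Mechanism}
    (hM : M ∈ feasibleMechanisms) : worstCaseRevenue uniform (hyperbolaCost t) M ≤
      maxWorstCaseRevenue uniform (hyperbolaCost t) :=
  le_ciSup (bddAbove_worstCaseRevenue ht ht') (⟨M, hM⟩ : feasibleMechanisms)

lemma maxWorstCaseRevenue_uniform (ht : 0 < t) (ht' : t < 1 / 2) :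
    maxWorstCaseRevenue uniform (hyperbolaCost t) = t * (1 - t) := by
  obtain ⟨Q, hQ⟩ := exists_le_worstCaseRevenue ht ht'
  have : Nonempty feasibleMechanisms := ⟨⟨_, randomizedPrice_mem Q⟩⟩
  exact le_antisymm (ciSup_le fun M => worstCaseRevenue_le_symm ht ht' M.2)
    (hQ.trans (worstCaseRevenue_le_max ht ht' (randomizedPrice_mem Q)))

lemma exists_isOptimalRO (ht : 0 < t) (ht' : t < 1 / 2) :
    ∃ Q, IsOptimalRO uniform (hyperbolaCost t) (randomizedPrice Q) := by
  obtain ⟨Q, hQ⟩ := exists_le_worstCaseRevenue ht ht'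
  refine ⟨Q, randomizedPrice_mem Q, ?_⟩
  rw [maxWorstCaseRevenue_uniform ht ht']
  exact le_antisymm (worstCaseRevenue_le_symm ht ht' (randomizedPrice_mem Q)) hQ

/-- Every optimal randomized price has the logarithmic mean of `t` and `1 - t` as its mean. -/
lemma IsOptimalRO.meanPrice_mul_logRatio (ht : 0 < t) (ht' : t < 1 / 2)
    {Q : ProbabilityMeasure unitInterval}
    (hQ : IsOptimalRO uniform (hyperbolaCost t) (randomizedPrice Q)) :
    meanPrice Q * logRatio t = 1 - 2 * t := by
  have hw : t * (1 - t) ≤ worstCaseRevenue uniform (hyperbolaCost t) (randomizedPrice Q) := by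
    rw [hQ.2, maxWorstCaseRevenue_uniform ht ht']
  have hr := hyperbolaCost_pos ht ht'
  set r := hyperbolaCost t with hrdef
  set μ := meanPrice Q
  -- This scale keeps the perturbed law at distance exactly `r`. Its revenue bound is then at least
  -- `t(1-t)` for `x` near `t`, with equality at `x = t`.
  set s : ℝ → ℝ := fun x => √(r / hyperbolaCost x) with hs
  have hst : s t = 1 := by simp [hs, ← hrdef, div_self hr.ne']
  have hsd : HasDerivAt s ((1 - 2 * t) * logRatio t / (2 * r)) t := by
    have h := (((hasDerivAt_const t r).div (hasDerivAt_hyperbolaCost ht ht') hr.ne').sqrt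
      (by simp only [Pi.div_apply, ← hrdef, div_self hr.ne', ne_eq, one_ne_zero, not_false_eq_true]))
    refine h.congr_deriv ?_
    simp only [Pi.div_apply, ← hrdef, div_self hr.ne', Real.sqrt_one]
    field_simp
    ring
  have hφd : HasDerivAt (fun x => s x ^ 2 * (x * (1 - x)) + (1 - s x) * μ)
      ((1 - 2 * t) * logRatio t / r * (t * (1 - t)) + (1 - 2 * t) -
        (1 - 2 * t) * logRatio t / (2 * r) * μ) t := by
    have h := ((hsd.pow 2).mul ((hasDerivAt_id t).mul ((hasDerivAt_id t).const_sub 1))).add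
      ((hsd.const_sub 1).mul_const μ)
    refine h.congr_deriv ?_
    simp only [id, Pi.mul_apply, Pi.pow_apply, hst]
    field_simp
    ring
  have hmin : IsLocalMin (fun x => s x ^ 2 * (x * (1 - x)) + (1 - s x) * μ) t := by
    have hc : ContinuousAt (fun x => s x * (1 - x)) t :=
      hsd.continuousAt.mul (by fun_prop)
    filter_upwards [Ioo_mem_nhds ht ht', hc.eventually_lt_const (by simp only [hst]; linarith :
      s t * (1 - t) < 1)] with x hx hx1
    have hxD := hyperbolaCost_pos hx.1 hx.2
    have hsx : 0 < s x := Real.sqrt_pos.2 (div_pos hr hxD)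
    have hd := wasserstein_hyperbolaLaw_mul hsx hx.1 hx.2 hx1.le
    have hsq : s x ^ 2 = r / hyperbolaCost x := Real.sq_sqrt (div_pos hr hxD).le
    have h1 := worstCaseRevenue_le (randomizedPrice_mem Q)
      (show wasserstein (hyperbolaLaw (s x * x) (s x * (1 - x))) uniform ≤ r by
        rw [hd, hsq, div_mul_cancel₀ _ hxD.ne'])
    have h2 := revenue_hyperbolaLaw_mul_le hsx hx.1 hx.2 hx1.le Q
    simp only [hst]
    linarith
  have h0 := hmin.hasDerivAt_eq_zero hφd
  have h1 : (1 - 2 * t) * (2 * (logRatio t * (t * (1 - t))) + 2 * r - logRatio t * μ) = 0 := by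
    field_simp at h0
    linarith
  have h2 := (mul_eq_zero.1 h1).resolve_left (by linarith)
  rw [hrdef, hyperbolaCost] at h2
  linarith

end RobustOptimization

/-! ### Robust satisficing over all mechanisms -/

section RobustSatisficing

variable {t τ : ℝ}

/-- The equation for `t` makes the log-uniform guarantee equal to `τ - d / logRatio t`. -/
lemma exists_satisfices (ht : 0 < t) (ht' : t < 1 / 2) (h : 2 * τ * logRatio t = 1 - 2 * t) :
    ∃ Q, Satisfices uniform τ (randomizedPrice Q) (1 / logRatio t) := by
  obtain ⟨Q, hQ⟩ := exists_randomizedPrice_revenue_ge_symm ht ht'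
  have hL := logRatio_pos ht ht'
  refine ⟨Q, by positivity, fun P => ?_⟩
  have h1 := hQ P
  rw [show ((1 - 2 * t) / 2 - wasserstein P uniform) / logRatio t =
    τ - 1 / logRatio t * wasserstein P uniform by rw [← h]; field_simp] at h1
  linarith

lemma hyperbolaCost_eq (h : 2 * τ * logRatio t = 1 - 2 * t) :
    hyperbolaCost t = (τ - t * (1 - t)) * logRatio t := by
  rw [hyperbolaCost, ← h]; ring

lemma Satisfices.one_div_logRatio_le (ht : 0 < t) (ht' : t < 1 / 2)
    (h : 2 * τ * logRatio t = 1 - 2 * t) {M : Mechanism} (hM : M ∈ feasibleMechanisms) {k : ℝ}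
    (hk : Satisfices uniform τ M k) : 1 / logRatio t ≤ k := by
  have hL := logRatio_pos ht ht'
  have hD := hyperbolaCost_pos ht ht'
  have h1 := hk.2 (hyperbolaLaw t (1 - t))
  have h2 := revenue_hyperbolaLaw_symm_le ht ht' hM
  rw [wasserstein_hyperbolaLaw_symm ht ht'] at h1
  rw [hyperbolaCost_eq h] at h1 hD
  have h3 : 0 < τ - t * (1 - t) := pos_of_mul_pos_left hD hL.le
  rw [div_le_iff₀ hL]
  refine le_of_mul_le_mul_left ?_ h3
  linarith

lemma exists_isOptimalRS (ht : 0 < t) (ht' : t < 1 / 2) (h : 2 * τ * logRatio t = 1 - 2 * t) :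
    ∃ Q, IsOptimalRS uniform τ (randomizedPrice Q) := by
  obtain ⟨Q, hQ⟩ := exists_satisfices ht ht' h
  exact ⟨Q, randomizedPrice_mem Q, _, hQ, fun M' hM' k' hk' =>
    hk'.one_div_logRatio_le ht ht' h hM'⟩

lemma IsOptimalRS.meanPrice_eq (ht : 0 < t) (ht' : t < 1 / 2)
    (h : 2 * τ * logRatio t = 1 - 2 * t) {Q : ProbabilityMeasure unitInterval}
    (hQ : IsOptimalRS uniform τ (randomizedPrice Q)) : meanPrice Q = 2 * τ := by
  have hL := logRatio_pos ht ht'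
  obtain ⟨-, k, hk, hmin⟩ := hQ
  obtain ⟨Q', hQ'⟩ := exists_satisfices ht ht' h
  have hkL : k * logRatio t ≤ 1 :=
    (le_div_iff₀ hL).1 (hmin _ (randomizedPrice_mem Q') _ hQ')
  have hD : k * hyperbolaCost t ≤ τ - t * (1 - t) := by
    have hD0 := hyperbolaCost_pos ht ht'
    rw [hyperbolaCost_eq h] at hD0 ⊢
    nlinarith [pos_of_mul_pos_left hD0 hL.le]
  -- Now only the scale varies. The RS constraint on the scaled laws gives `τ ≤ s² τ + (1 - s) ·
  -- meanPrice Q`, an equality at `s = 1`.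
  have hd : HasDerivAt (fun s : ℝ => s ^ 2 * τ + (1 - s) * meanPrice Q) (2 * τ - meanPrice Q) 1 := by
    have := (((hasDerivAt_id (1 : ℝ)).pow 2).mul_const τ).add
      (((hasDerivAt_id (1 : ℝ)).const_sub 1).mul_const (meanPrice Q))
    refine this.congr_deriv ?_
    simp
    ring
  have hloc : IsLocalMin (fun s : ℝ => s ^ 2 * τ + (1 - s) * meanPrice Q) 1 := by
    have hc : ContinuousAt (fun s : ℝ => s * (1 - t)) 1 := by fun_prop
    filter_upwards [lt_mem_nhds one_pos, hc.eventually_lt_const (by linarith : 1 * (1 - t) < 1)]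
      with s hs hs1
    have h1 := hk.2 (hyperbolaLaw (s * t) (s * (1 - t)))
    rw [wasserstein_hyperbolaLaw_mul hs ht ht' hs1.le] at h1
    have h2 := revenue_hyperbolaLaw_mul_le hs ht ht' hs1.le Q
    have h3 := mul_le_mul_of_nonneg_left hD (sq_nonneg s)
    simp only [one_pow, one_mul, sub_self, zero_mul, add_zero]
    nlinarith
  linarith [hloc.hasDerivAt_eq_zero hd]

end RobustSatisficing

/-! ### Posted prices -/

section PostedPrice

lemma one_sub_le_wasserstein (P : Valuation) {p : ℝ} (hp : 0 ≤ p) :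
    1 - p - √(2 * wasserstein P uniform) ≤ tail P p := by
  rcases le_total (tail P p) (1 - p) with h | h
  · have h1 := Real.le_sqrt_of_sq_le (x := 1 - p - tail P p)
      (by linarith [sq_le_wasserstein P hp h] :
        (1 - p - tail P p) ^ 2 ≤ 2 * wasserstein P uniform)
    linarith
  · linarith [Real.sqrt_nonneg (2 * wasserstein P uniform)]

lemma le_worstCaseRevenue_postedPrice {r : ℝ} (hr : 0 ≤ r) (p : unitInterval) :
    p * (1 - p - √(2 * r)) ≤ worstCaseRevenue uniform r (postedPrice p) := by
  refine le_worstCaseRevenue hr fun P hP => ?_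
  rw [revenue_postedPrice]
  have h1 := one_sub_le_wasserstein P p.2.1
  have h2 : √(2 * wasserstein P uniform) ≤ √(2 * r) := Real.sqrt_le_sqrt (by linarith)
  exact mul_le_mul_of_nonneg_left (by linarith) p.2.1

lemma worstCaseRevenue_postedPrice_le {r : ℝ} (hr : 0 < r) (p : unitInterval) :
    worstCaseRevenue uniform r (postedPrice p) ≤ max 0 (p * (1 - p - √(2 * r))) := by
  have hp1 := p.2.2
  rcases p.2.1.eq_or_lt with hp | hp
  · refine le_max_of_le_left ?_
    refine (worstCaseRevenue_le (postedPrice_mem p) (by rw [wasserstein_self]; exact hr.le)).trans ?_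
    rw [revenue_postedPrice, ← hp, zero_mul]
  set w := √(2 * r) with hw
  have hw0 : 0 < w := Real.sqrt_pos.2 (by linarith)
  have hw2 : w ^ 2 = 2 * r := Real.sq_sqrt (by linarith)
  have key : ∀ c e : unitInterval, c < p → p ≤ e → (e : ℝ) - c ≤ w →
      worstCaseRevenue uniform r (postedPrice p) ≤ p * (1 - e) := fun c e hc he h => by
    have hce : (c : ℝ) ≤ e := (hc.le.trans he)
    refine (worstCaseRevenue_le (postedPrice_mem p) (P := poolLaw c e) ?_).trans_eq ?_
    · rw [wasserstein_poolLaw (hc.le.trans he)]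
      nlinarith
    · rw [revenue_postedPrice, tail_poolLaw hc he]
  refine le_of_forall_pos_le_add fun ε hε => ?_
  obtain ⟨δ, hδ0, hδε, hδw, hδp⟩ : ∃ δ : ℝ, 0 < δ ∧ δ ≤ ε ∧ δ ≤ w ∧ δ ≤ p :=
    ⟨min ε (min w p), lt_min hε (lt_min hw0 hp), min_le_left _ _,
      (min_le_right _ _).trans (min_le_left _ _), (min_le_right _ _).trans (min_le_right _ _)⟩
  have hc : (p : ℝ) - δ ∈ unitInterval := ⟨by linarith, by linarith⟩
  -- If the pooled interval would pass `1`, nature can afford to destroy all sales; hence the `max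
  -- 0`.
  rcases le_or_gt (p - δ + w) 1 with h | h
  · have h1 := key ⟨p - δ, hc⟩ ⟨p - δ + w, by linarith, h⟩
      (Subtype.coe_lt_coe.1 (by simp only; linarith)) (Subtype.coe_le_coe.1 (by simp only; linarith))
      (by simp only; linarith)
    have h2 := le_max_right 0 ((p : ℝ) * (1 - p - w))
    simp only at h1
    nlinarith
  · have h1 := key ⟨p - δ, hc⟩ 1 (Subtype.coe_lt_coe.1 (by simp only; linarith)) p.2.2
      (by simp only [Icc.coe_one]; linarith)
    have h2 := le_max_left 0 ((p : ℝ) * (1 - p - w))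
    simp only [Icc.coe_one, sub_self, mul_zero] at h1
    linarith

variable {r : ℝ}

lemma robust_postedPrice_mem (hr : 0 < r) (hr' : r < 1 / 2) :
    0 < 1 - √(2 * r) ∧ (1 - √(2 * r)) / 2 ∈ unitInterval := by
  have hw0 := Real.sqrt_nonneg (2 * r)
  have hw1 : √(2 * r) < 1 := by rw [Real.sqrt_lt' one_pos]; linarith
  exact ⟨by linarith, by linarith, by linarith⟩

lemma exists_isOptimalPriceRO (hr : 0 < r) (hr' : r < 1 / 2) :
    ∃ p, IsOptimalPriceRO uniform r p := by
  obtain ⟨hw, hmem⟩ := robust_postedPrice_mem hr hr'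
  refine ⟨⟨_, hmem⟩, fun p' => (worstCaseRevenue_postedPrice_le hr p').trans
    (le_trans (max_le ?_ ?_) (le_worstCaseRevenue_postedPrice hr.le _))⟩
  · simp only; nlinarith
  · simp only; nlinarith [sq_nonneg ((p' : ℝ) - (1 - √(2 * r)) / 2)]

lemma IsOptimalPriceRO.eq (hr : 0 < r) (hr' : r < 1 / 2) {p : unitInterval}
    (hp : IsOptimalPriceRO uniform r p) : (p : ℝ) = (1 - √(2 * r)) / 2 := by
  obtain ⟨hw, hmem⟩ := robust_postedPrice_mem hr hr'
  have h := ((le_worstCaseRevenue_postedPrice hr.le ⟨_, hmem⟩).trans (hp _)).trans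
    (worstCaseRevenue_postedPrice_le hr p)
  simp only at h
  rcases le_max_iff.1 h with h | h
  · nlinarith
  · have : ((p : ℝ) - (1 - √(2 * r)) / 2) ^ 2 ≤ 0 := by nlinarith
    linarith [pow_eq_zero_iff two_ne_zero |>.1 (le_antisymm this (sq_nonneg _))]

variable {τ : ℝ}

/-- With `y` the shortfall of the sale probability below `1 - 2τ`, the constraint reduces to `(y -
(1 - 4τ))² ≥ 0`; the fragility is the one giving tangency, at `y = 1 - 4τ`. -/
lemma satisfices_postedPrice (h0 : 0 < τ) (h1 : τ < 1 / 4) {p : unitInterval}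
    (hp : (p : ℝ) = 2 * τ) : Satisfices uniform τ (postedPrice p) (2 * τ / (1 - 4 * τ)) := by
  have hk : 0 < 1 - 4 * τ := by linarith
  refine ⟨by positivity, fun P => ?_⟩
  rw [revenue_postedPrice, hp]
  have hd := wasserstein_nonneg P uniform
  have key : τ - 2 * τ * tail P (2 * τ) ≤
      2 * τ / (1 - 4 * τ) * ((max 0 (1 - 2 * τ - tail P (2 * τ))) ^ 2 / 2) := by
    rw [div_mul_eq_mul_div, le_div_iff₀ hk]
    rcases le_total 0 (1 - 2 * τ - tail P (2 * τ)) with h | h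
    · rw [max_eq_right h]
      nlinarith [mul_nonneg h0.le (sq_nonneg (1 - 2 * τ - tail P (2 * τ) - (1 - 4 * τ)))]
    · rw [max_eq_left h]
      have h2 : τ - 2 * τ * tail P (2 * τ) ≤ 0 := by
        nlinarith [mul_nonneg h0.le (neg_nonneg.2 h), mul_pos h0 hk]
      linarith [mul_nonneg (neg_nonneg.2 h2) hk.le]
  refine key.trans (mul_le_mul_of_nonneg_left ?_ (by positivity))
  rcases le_total 0 (1 - 2 * τ - tail P (2 * τ)) with h | h
  · rw [max_eq_right h]
    exact sq_le_wasserstein P (by positivity) (by linarith)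
  · rw [max_eq_left h]; simpa using hd

lemma Satisfices.pos_of_postedPrice (h0 : 0 < τ) {p : unitInterval} {k : ℝ}
    (h : Satisfices uniform τ (postedPrice p) k) : 0 < (p : ℝ) := by
  refine p.2.1.lt_of_ne fun hp => ?_
  have := h.2 uniform
  rw [revenue_postedPrice, ← hp, wasserstein_self] at this
  linarith

lemma Satisfices.le_of_postedPrice (h0 : 0 < τ) {p : unitInterval} {k a : ℝ}
    (h : Satisfices uniform τ (postedPrice p) k) (ha : 0 ≤ a) (ha' : p + a ≤ 1) :
    τ ≤ p * (1 - p - a) + k * (a ^ 2 / 2) := by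
  -- Pool `(p - δ, p + a]` at `p - δ` and let `δ → 0`.
  have hp := h.pos_of_postedPrice h0
  have hlim : Tendsto (fun δ : ℝ => p * (1 - p - a) + k * ((a + δ) ^ 2 / 2)) (𝓝[>] 0)
      (𝓝 (p * (1 - p - a) + k * ((a + 0) ^ 2 / 2))) :=
    Tendsto.mono_left (Continuous.tendsto (by fun_prop) 0) nhdsWithin_le_nhds
  rw [add_zero] at hlim
  refine ge_of_tendsto hlim ?_
  filter_upwards [Ioo_mem_nhdsGT hp] with δ hδ
  have hc : (p : ℝ) - δ ∈ unitInterval := ⟨by linarith [hδ.2], by linarith [hδ.1, p.2.2]⟩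
  have he : (p : ℝ) + a ∈ unitInterval := ⟨by linarith, ha'⟩
  have hcp : ((⟨p - δ, hc⟩ : unitInterval) : ℝ) < p := by simp only; linarith [hδ.1]
  have hpe : (p : ℝ) ≤ (⟨p + a, he⟩ : unitInterval) := by simp only; linarith
  have h1 := h.2 (poolLaw ⟨p - δ, hc⟩ ⟨p + a, he⟩)
  rw [revenue_postedPrice, tail_poolLaw hcp hpe,
    wasserstein_poolLaw (Subtype.coe_le_coe.1 (hcp.le.trans hpe))] at h1
  simp only [add_sub_sub_cancel] at h1
  linarith [show (p : ℝ) + a - (p - δ) = a + δ by ring]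

lemma Satisfices.eq_of_postedPrice (h0 : 0 < τ) (h1 : τ < 1 / 4) {p : unitInterval}
    (h : Satisfices uniform τ (postedPrice p) (2 * τ / (1 - 4 * τ))) : (p : ℝ) = 2 * τ := by
  have hk : 0 < 1 - 4 * τ := by linarith
  have hp := h.pos_of_postedPrice h0
  have hp1 := p.2.2
  -- Nature's best `a` is `p / k`, which forces `(p - 2τ)² ≤ 0`. If `p + a` exceeds `1`, the
  -- boundary choice `a = 1 - p` already violates the constraint.
  rcases le_or_gt (p + p * (1 - 4 * τ) / (2 * τ)) 1 with h2 | h2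
  · have h3 := h.le_of_postedPrice h0 (by positivity) h2
    have h4 : (p : ℝ) * (1 - p - p * (1 - 4 * τ) / (2 * τ)) +
        2 * τ / (1 - 4 * τ) * ((p * (1 - 4 * τ) / (2 * τ)) ^ 2 / 2) = p - p ^ 2 / (4 * τ) := by
      field_simp
      ring
    rw [h4] at h3
    have h5 : (p : ℝ) ^ 2 / (4 * τ) * (4 * τ) = p ^ 2 := by field_simp
    have : ((p : ℝ) - 2 * τ) ^ 2 ≤ 0 := by nlinarith
    linarith [pow_eq_zero_iff two_ne_zero |>.1 (le_antisymm this (sq_nonneg _))]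
  · exfalso
    have h3 := h.le_of_postedPrice h0 (a := 1 - p) (by linarith) (by linarith)
    rw [show (p : ℝ) * (1 - p - (1 - p)) + 2 * τ / (1 - 4 * τ) * ((1 - p) ^ 2 / 2) =
      τ * ((1 - p) ^ 2 / (1 - 4 * τ)) by field_simp; ring] at h3
    have h4 : 1 ≤ (1 - (p : ℝ)) ^ 2 / (1 - 4 * τ) := le_of_mul_le_mul_left (by linarith) h0
    rw [one_le_div hk] at h4
    rw [← sub_lt_iff_lt_add', lt_div_iff₀ (by positivity)] at h2
    have h5 : (1 - (p : ℝ)) * (1 - 2 * τ) < 1 - 4 * τ := by linarith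
    have h6 : 0 ≤ (1 - (p : ℝ)) * (1 - 2 * τ) := mul_nonneg (by linarith) (by linarith)
    have h7 := mul_self_lt_mul_self h6 h5
    nlinarith [mul_le_mul_of_nonneg_right h4 (sq_nonneg (1 - 2 * τ)), mul_pos hk (mul_pos h0 h0)]

lemma Satisfices.le_fragility_of_postedPrice (h0 : 0 < τ) (h1 : τ < 1 / 4) {p : unitInterval}
    {k : ℝ} (h : Satisfices uniform τ (postedPrice p) k) : 2 * τ / (1 - 4 * τ) ≤ k := by
  have hk : 0 < 1 - 4 * τ := by linarith
  by_contra! hlt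
  -- A smaller fragility would satisfice with the larger one too, forcing `p = 2τ`; the tangency
  -- point `a = 1 - 4τ` then refutes it.
  have hp := Satisfices.eq_of_postedPrice h0 h1 (p := p) ⟨h.1.trans hlt, fun P =>
    (h.2 P).trans (mul_le_mul_of_nonneg_right hlt.le (wasserstein_nonneg _ _))⟩
  have h3 := h.le_of_postedPrice h0 (a := 1 - 4 * τ) hk.le (by linarith)
  rw [lt_div_iff₀ hk] at hlt
  rw [hp] at h3
  nlinarith

lemma exists_isOptimalPriceRS (h0 : 0 < τ) (h1 : τ < 1 / 4) :
    ∃ p, IsOptimalPriceRS uniform τ p :=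
  ⟨⟨2 * τ, by linarith, by linarith⟩, _, satisfices_postedPrice h0 h1 rfl,
    fun _ _ h => h.le_fragility_of_postedPrice h0 h1⟩

lemma IsOptimalPriceRS.eq (h0 : 0 < τ) (h1 : τ < 1 / 4) {p : unitInterval}
    (hp : IsOptimalPriceRS uniform τ p) : (p : ℝ) = 2 * τ := by
  obtain ⟨k, hk, hmin⟩ := hp
  have hle := hmin ⟨2 * τ, by linarith, by linarith⟩ _ (satisfices_postedPrice h0 h1 rfl)
  rw [le_antisymm hle (hk.le_fragility_of_postedPrice h0 h1)] at hk
  exact hk.eq_of_postedPrice h0 h1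

end PostedPrice

end RobustPricing

end

theorem proposition9 (r τ : ℝ) (hr : 0 < r) (hr' : r < 1 / 2)
    (hτ : τ = RobustPricing.maxWorstCaseRevenue RobustPricing.uniform r) :
    -- the four optimization problems have solutions
    (∃ Q, RobustPricing.IsOptimalRO RobustPricing.uniform r (RobustPricing.randomizedPrice Q)) ∧
    (∃ Q, RobustPricing.IsOptimalRS RobustPricing.uniform τ (RobustPricing.randomizedPrice Q)) ∧
    (∃ p, RobustPricing.IsOptimalPriceRO RobustPricing.uniform r p) ∧
    (∃ p, RobustPricing.IsOptimalPriceRS RobustPricing.uniform τ p) ∧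
    -- the comparison, for all solutions
    ∀ (QRO QRS : MeasureTheory.ProbabilityMeasure unitInterval) (pRO pRS : unitInterval),
      RobustPricing.IsOptimalRO RobustPricing.uniform r (RobustPricing.randomizedPrice QRO) →
      RobustPricing.IsOptimalRS RobustPricing.uniform τ (RobustPricing.randomizedPrice QRS) →
      RobustPricing.IsOptimalPriceRO RobustPricing.uniform r pRO →
      RobustPricing.IsOptimalPriceRS RobustPricing.uniform τ pRS →
      RobustPricing.meanPrice QRS < RobustPricing.meanPrice QRO ∧
      RobustPricing.meanPrice QRS = (pRS : ℝ) ∧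
      (pRO : ℝ) = (1 - Real.sqrt (2 * r)) / 2 ∧
      (pRO : ℝ) < RobustPricing.meanPrice QRO := by
  obtain ⟨t₀, h0, h1, rfl⟩ := RobustPricing.exists_hyperbolaCost_eq hr hr'
  rw [RobustPricing.maxWorstCaseRevenue_uniform h0 h1] at hτ
  have hτ0 : 0 < τ := by rw [hτ]; exact mul_pos h0 (by linarith)
  have hτ1 : τ < 1 / 4 := by rw [hτ]; nlinarith [mul_pos (sub_pos.2 h1) (sub_pos.2 h1)]
  have hlog : 2 * τ * RobustPricing.logRatio t₀ < 1 - 2 * t₀ := by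
    rw [hτ]; exact RobustPricing.two_mul_mul_logRatio_lt h0 h1
  obtain ⟨t₁, g0, g1, ht₁⟩ := RobustPricing.exists_logMean_eq (by linarith) h0 h1 hlog
  refine ⟨RobustPricing.exists_isOptimalRO h0 h1, RobustPricing.exists_isOptimalRS g0 g1 ht₁,
    RobustPricing.exists_isOptimalPriceRO hr hr', RobustPricing.exists_isOptimalPriceRS hτ0 hτ1,
    fun QRO QRS pRO pRS hRO hRS hpRO hpRS => ?_⟩
  have hL := RobustPricing.logRatio_pos h0 h1
  have m1 := hRO.meanPrice_mul_logRatio h0 h1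
  have m2 := hRS.meanPrice_eq g0 g1 ht₁
  have p1 := hpRO.eq hr hr'
  have p2 := hpRS.eq hτ0 hτ1
  -- The geometric mean `√τ` separates the RO mean from the posted RO price.
  have hgm : √τ < RobustPricing.meanPrice QRO := by
    refine lt_of_mul_lt_mul_right ?_ hL.le
    rw [m1, hτ]
    exact RobustPricing.sqrt_mul_logRatio_lt h0 h1
  refine ⟨?_, m2.trans p2.symm, p1, lt_of_le_of_lt ?_ hgm⟩
  · refine lt_of_mul_lt_mul_right ?_ hL.le
    rwa [m1, m2]
  · refine Real.le_sqrt_of_sq_le ?_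
    -- Here `1 - pRO - √(2r) = pRO`, so the guarantee of this price is `pRO ^ 2`.
    have h := (RobustPricing.le_worstCaseRevenue_postedPrice hr.le pRO).trans
      (RobustPricing.worstCaseRevenue_le_max h0 h1 (RobustPricing.postedPrice_mem pRO))
    rw [RobustPricing.maxWorstCaseRevenue_uniform h0 h1, ← hτ,
      show √(2 * RobustPricing.hyperbolaCost t₀) = 1 - 2 * pRO by rw [p1]; ring] at h
    nlinarith
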